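/- For positive integers $k,\ell$ let $P^\ell_k$ be the polynomial in $\ell^{2k}$ commuting variables over $\mathbb{R}$ defined recursively by $$P^\ell_1(x_1,\dots,x_{\ell^2})=\sum_{i=1}^{\ell}\prod_{j=1}^{\ell}x_{(i-1)\ell+j},$$ $$P^\ell_{k+1}(x_1,\dots,x_{\ell^{2k+2}})=\sum_{i=1}^{\ell}\prod_{j=1}^{\ell}P^\ell_k\bigl(x_{(i-1)\ell^{2k+1}+(j-1)\ell^{2k}+1},\dots,x_{(i-1)\ell^{2k+1}+j\ell^{2k}}\bigr).$$ An arithmetic circuit over $\mathbb{R}$ is a finite directed acyclic graph whose nodes of indegree zero (leaves) are labelled by variables or real constants and whose other nodes have indegree two (the two inputs may coincide) and are labelled by $+$ or $\times$; a designated output node computes the polynomial of the circuit. It is layered if its nodes are partitioned into layers $V_1,\dots,V_t$ such that $V_1$ consists only of leaves and, for $i>1$, the children of every internal node in $V_i$ lie in $V_1\cup V_{i-1}$. Its width is $\max_{i>1}|V_i|$, its size is the total number of nodes (leaves included), and it is monotone if all constants used are nonnegative. For a polynomial $f$, let $\mathrm{mon}(f)$ be the set of monomials with nonzero coefficient in $f$,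 and for a circuit $C$ let $\mathrm{mon}(C)=\mathrm{mon}(f)$, where $f$ is the polynomial computed by $C$. **Theorem.** For each integer $k>0$ there is a positive integer $\ell_0$ such that for all integers $\ell>\ell_0$ the following holds. Every monotone layered circuit $C$ of width at most $k$ in the $\ell^{2k}$ variables of $P^\ell_k$ with $$\mathrm{mon}(C)\subseteq\mathrm{mon}(P^\ell_k)\quad\text{and}\quad|\mathrm{mon}(C)|\ge\frac{|\mathrm{mon}(P^\ell_k)|}{2}$$ has size at least $2^\ell/10$. In particular, every monotone layered circuit of width at most $k$ that computes $P^\ell_k$ has size at least $2^\ell/10$. -/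

import Mathlib

open MvPolynomial

/-- The label of a node of an arithmetic circuit with set of nodes `N`: a leaf is labelled by a
variable or by a scalar, an internal node is a plus gate or a multiply gate with two inputs
(which may coincide). -/
inductive NodeLabel (R σ N : Type*) where
  | var (x : σ)
  | const (c : R)
  | add (u w : N)
  | mul (u w : N)

namespace NodeLabel

/-- The input nodes; leaves have none. -/
def children {R σ N : Type*} : NodeLabel R σ N → List N
  | var _ => []
  | const _ => []
  | add u w => [u, w]
  | mul u w => [u, w]

end NodeLabel

/-- A layered arithmetic circuit with scalars in `R` and variables indexed by `σ`. The layers are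
`V_1, V_2, …`, where `V_i` is the set of nodes `v` with `layer v = i`. -/
structure LayeredCircuit (R σ : Type*) where
  Node : Type
  [fintypeNode : Fintype Node]
  label : Node → NodeLabel R σ Node
  layer : Node → ℕ
  one_le_layer : ∀ v, 1 ≤ layer v
  /-- The first layer consists only of leaves. -/
  leaf_of_layer_eq_one : ∀ v, layer v = 1 → (label v).children = []
  /-- The children of a node of `V_i` belong to `V_1` or to `V_{i-1}`. -/
  layer_child : ∀ v, ∀ u ∈ (label v).children, layer u = 1 ∨ layer u + 1 = layer v
  output : Node

namespace LayeredCircuit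

attribute [instance] LayeredCircuit.fintypeNode

variable {R σ : Type*}

/-- Inputs lie in strictly lower layers, so the underlying directed graph is acyclic. -/
theorem layer_lt (C : LayeredCircuit R σ) {v u : C.Node} (h : u ∈ (C.label v).children) :
    C.layer u < C.layer v := by
  have h1 := C.one_le_layer v
  have h2 : C.layer v ≠ 1 := fun h0 => by
    rw [C.leaf_of_layer_eq_one v h0] at h
    simp at h
  rcases C.layer_child v u h with h3 | h3 <;> omega

/-- The number of nodes (leaves included). -/
def size (C : LayeredCircuit R σ) : ℕ := Fintype.card C.Node

/-- The number `|V_i|` of nodes in layer `i`. -/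
def layerCard (C : LayeredCircuit R σ) (i : ℕ) : ℕ :=
  (Finset.univ.filter fun v => C.layer v = i).card

/-- The index of the last nonempty layer. -/
def lastLayer (C : LayeredCircuit R σ) : ℕ := Finset.univ.sup C.layer

/-- The width `max_{i > 1} |V_i|` (it is `0` if there is only one layer). -/
def width (C : LayeredCircuit R σ) : ℕ := (Finset.Icc 2 C.lastLayer).sup C.layerCard

/-- The polynomial computed at a node. -/
noncomputable def nodePoly [CommSemiring R] (C : LayeredCircuit R σ) (v : C.Node) :
    MvPolynomial σ R :=
  match h : C.label v with
  | .var x => MvPolynomial.X x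
  | .const c => MvPolynomial.C c
  | .add u w => C.nodePoly u + C.nodePoly w
  | .mul u w => C.nodePoly u * C.nodePoly w
termination_by C.layer v
decreasing_by all_goals exact C.layer_lt (by simp [h, NodeLabel.children])

theorem nodePoly_var [CommSemiring R] (C : LayeredCircuit R σ) {v : C.Node} {x : σ}
    (h : C.label v = .var x) : C.nodePoly v = MvPolynomial.X x := by
  unfold nodePoly; split <;> simp_all

theorem nodePoly_const [CommSemiring R] (C : LayeredCircuit R σ) {v : C.Node} {c : R}
    (h : C.label v = .const c) : C.nodePoly v = MvPolynomial.C c := by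
  unfold nodePoly; split <;> simp_all

theorem nodePoly_add [CommSemiring R] (C : LayeredCircuit R σ) {v u w : C.Node}
    (h : C.label v = .add u w) : C.nodePoly v = C.nodePoly u + C.nodePoly w := by
  rw [nodePoly.eq_def C v]; split <;> simp_all

theorem nodePoly_mul [CommSemiring R] (C : LayeredCircuit R σ) {v u w : C.Node}
    (h : C.label v = .mul u w) : C.nodePoly v = C.nodePoly u * C.nodePoly w := by
  rw [nodePoly.eq_def C v]; split <;> simp_all

/-- The polynomial computed by the circuit. -/
noncomputable def poly [CommSemiring R] (C : LayeredCircuit R σ) : MvPolynomial σ R :=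
  C.nodePoly C.output

/-- A circuit over the reals is monotone if all the scalars used are nonnegative. -/
def IsMonotone (C : LayeredCircuit ℝ σ) : Prop :=
  ∀ v c, C.label v = NodeLabel.const c → 0 ≤ c

end LayeredCircuit

/-- The position `i ℓ^{2k+1} + j ℓ^{2k} + v` among `ℓ^{2(k+1)}` variables (all indices are counted
from `0`): the `v`-th variable of the block with number `(i, j)`. -/
def blockIndex (ℓ k : ℕ) (i j : Fin ℓ) (v : Fin (ℓ ^ (2 * k))) : Fin (ℓ ^ (2 * (k + 1))) :=
  ⟨i * ℓ ^ (2 * k + 1) + j * ℓ ^ (2 * k) + v, by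
    have hi : (i : ℕ) + 1 ≤ ℓ := i.2
    have hj : (j : ℕ) + 1 ≤ ℓ := j.2
    have hv := v.2
    have h1 := Nat.mul_le_mul_right (ℓ ^ (2 * k + 1)) hi
    have h2 := Nat.mul_le_mul_right (ℓ ^ (2 * k)) hj
    have e1 : ℓ ^ (2 * (k + 1)) = ℓ * ℓ ^ (2 * k + 1) := by ring
    have e2 : ℓ ^ (2 * k + 1) = ℓ * ℓ ^ (2 * k) := by ring
    rw [add_mul, one_mul] at h1 h2
    omega⟩

/-- The alternating sum-of-products polynomial `P^ℓ_k` in `ℓ^{2k}` variables. The recursion starts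
from a single variable at `k = 0`; `altPoly_one` gives the usual starting point `k = 1`. -/
noncomputable def altPoly (ℓ : ℕ) : (k : ℕ) → MvPolynomial (Fin (ℓ ^ (2 * k))) ℝ
  | 0 => X ⟨0, by simp⟩
  | k + 1 => ∑ i : Fin ℓ, ∏ j : Fin ℓ, rename (blockIndex ℓ k i j) (altPoly ℓ k)

theorem altPoly_one (ℓ : ℕ) :
    altPoly ℓ 1 = ∑ i : Fin ℓ, ∏ j : Fin ℓ,
      X (⟨i * ℓ + j, by
        have hi : (i : ℕ) + 1 ≤ ℓ := i.2
        have hj := j.2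
        have h1 := Nat.mul_le_mul_right ℓ hi
        have e : ℓ ^ (2 * 1) = ℓ * ℓ := by ring
        rw [add_mul, one_mul] at h1
        omega⟩ : Fin (ℓ ^ (2 * 1))) := by
  simp only [altPoly]
  refine Finset.sum_congr rfl fun i _ => Finset.prod_congr rfl fun j _ => ?_
  rw [rename_X]
  congr 1
  ext
  simp [blockIndex]

/-! Nonnegative coefficients never cancel, so a monotone circuit becomes a program on sets of
monomials, with `+` as union and `×` as Minkowski sum (`IsMonotone.isProgram`). Leaves have degree
at most one and are free. The bound is then proved by induction on the width.

The monomials of `altPoly ℓ (k + 1)` split into `ℓ` rows, and a product of nonconstant factors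
cannot mix rows. Hence each output monomial arises at a product gate confined to one row whose value
reaches the output additively (`exists_mul_gate`).

The heart is `IsProgram.exists_rows`. An additive path from the output occupies a node in every
layer down to some lowest layer. By homogeneity, additively used nodes contribute nothing under a
nonconstant multiplier, so the factors of a product gate are computed with one node less per layer.
Information from below the path passes through a single layer, where each node serves at most one
row; this makes at most `k + 1` rows exceptional.

Restricting a gate of any other row to a block gives a program of smaller width for `altPoly ℓ k`,
which by induction gets less than half of the block's monomials. Over `ℓ` blocks the gate has at
most a fraction `2⁻ˡ` (with `l = ℓ`) of its row, so fewer than `2 ^ ℓ / 10` gates cover at most a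
tenth of one row's count. With the exceptional rows this is below half of `ℓ` rows
(`two_mul_ncard_lt_of_cover`). In width one there are no intermediate nodes left, and degree at most
two is already a contradiction. -/

open scoped Pointwise

/-! ### Set programs and multipliers along paths to the output. -/

/-- A set of monomials of degree at most one. -/
def IsDegreeLEOne {σ : Type*} (A : Set (σ →₀ ℕ)) : Prop :=
  ∀ a ∈ A, a.degree ≤ 1

/-- All the variables of the monomial `m` lie in row `i`. -/
def InRow {σ ρ : Type*} (row : σ → ρ) (i : ρ) (m : σ →₀ ℕ) : Prop :=
  ∀ x, m x ≠ 0 → row x = i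

/-- The sets of monomials that may be fed into a gate of layer `t`. -/
def IsInput {N σ : Type*} (layer : N → ℕ) (M : N → Set (σ →₀ ℕ)) (t : ℕ)
    (A : Set (σ →₀ ℕ)) : Prop :=
  IsDegreeLEOne A ∨ ∃ u, layer u + 1 = t ∧ A = M u

/-- A layered program computing sets of monomials with unions and Minkowski sums; all sets of
monomials of degree at most one are available for free. -/
def IsProgram {N σ : Type*} (layer : N → ℕ) (M : N → Set (σ →₀ ℕ)) : Prop :=
  ∀ v, ∃ A B, IsInput layer M (layer v) A ∧ IsInput layer M (layer v) B ∧
    (M v = A ∪ B ∨ M v = A + B)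

/-- `Used layer M r u q` says that `u` is linked to `r` through consecutive layers in such a way
that the monomials of `u` times `q` are monomials of `r`. -/
inductive Used {N σ : Type*} (layer : N → ℕ) (M : N → Set (σ →₀ ℕ)) (r : N) :
    N → (σ →₀ ℕ) → Prop
  | root : Used layer M r r 0
  | step {u v : N} {q b : σ →₀ ℕ} : Used layer M r v q → layer u + 1 = layer v →
      (∀ m ∈ M u, b + m ∈ M v) → Used layer M r u (q + b)

namespace Used

variable {N σ : Type*} {layer : N → ℕ} {M : N → Set (σ →₀ ℕ)} {r : N}

theorem add_mem {u : N} {q : σ →₀ ℕ} (h : Used layer M r u q) : ∀ m ∈ M u, q + m ∈ M r := by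
  induction h with
  | root => simp
  | step _ _ hb ih =>
    intro m hm
    rw [add_assoc]
    exact ih _ (hb m hm)

theorem subset {u : N} (h : Used layer M r u 0) : M u ⊆ M r := fun m hm => by
  simpa using h.add_mem m hm

theorem of_subset {u v : N} {q : σ →₀ ℕ} (h : Used layer M r v q) (hl : layer u + 1 = layer v)
    (hs : M u ⊆ M v) : Used layer M r u q := by
  simpa using h.step (b := 0) hl fun m hm => by simpa using hs hm

theorem eq_zero_or_exists {u : N} {q : σ →₀ ℕ} (h : Used layer M r u q) (hq : q = 0) :
    u = r ∨ ∃ v, layer u + 1 = layer v ∧ Used layer M r v 0 := by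
  cases h with
  | root => exact Or.inl rfl
  | step hv hl _ =>
    rw [add_eq_zero] at hq
    exact Or.inr ⟨_, hl, hq.1 ▸ hv⟩

theorem layer_le {u : N} {q : σ →₀ ℕ} (h : Used layer M r u q) : layer u ≤ layer r := by
  induction h with
  | root => exact le_rfl
  | step _ _ _ ih => omega

/-- Multipliers cannot cancel, so a chain with total multiplier `0` has multiplier `0` at every
step; climbing it visits each layer. -/
theorem exists_of_le {u : N} (h : Used layer M r u 0) {t : ℕ} (ht : layer u ≤ t)
    (ht' : t ≤ layer r) : ∃ v, layer v = t ∧ Used layer M r v 0 := by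
  induction t, ht using Nat.le_induction with
  | base => exact ⟨u, rfl, h⟩
  | succ t _ ih =>
    obtain ⟨v, hv, hu⟩ := ih (by omega)
    rcases hu.eq_zero_or_exists rfl with rfl | ⟨v', hv', hu'⟩
    · omega
    · exact ⟨v', by omega, hu'⟩

end Used

/-! ### Separation of rows and reduction of the width. -/

section Rows

variable {N σ ρ : Type*} {layer : N → ℕ} {M : N → Set (σ →₀ ℕ)} {row : σ → ρ}

theorem InRow.of_add_left {i : ρ} {a b : σ →₀ ℕ} (h : InRow row i (a + b)) : InRow row i a :=
  fun x hx => h x (by simp [hx])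

theorem InRow.of_add_right {i : ρ} {a b : σ →₀ ℕ} (h : InRow row i (a + b)) : InRow row i b :=
  fun x hx => h x (by simp [hx])

theorem InRow.add {i : ρ} {a b : σ →₀ ℕ} (ha : InRow row i a) (hb : InRow row i b) :
    InRow row i (a + b) := fun x hx => by
  by_cases h : a x = 0
  · exact hb x (by simpa [h] using hx)
  · exact ha x h

theorem InRow.unique {i j : ρ} {a : σ →₀ ℕ} (ha : a ≠ 0) (hi : InRow row i a)
    (hj : InRow row j a) : i = j := by
  obtain ⟨x, hx⟩ := Finsupp.ne_iff.1 ha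
  exact (hi x hx).symm.trans (hj x hx)

/-- A multiplication gate with nonconstant factors lies in a single row. -/
theorem inRow_of_mem_add {T A B : Set (σ →₀ ℕ)}
    (hrow : ∀ m ∈ T, ∃ i, InRow row i m) (hAB : A + B ⊆ T) {a b : σ →₀ ℕ} (ha : a ∈ A)
    (hb : b ∈ B) (ha0 : a ≠ 0) (hb0 : b ≠ 0) {i : ρ} (hi : InRow row i (a + b)) :
    ∀ m ∈ A + B, InRow row i m := by
  -- A nonzero part `c` fixes the row of the whole monomial. Exchanging one factor at a time keeps
  -- such a part.
  have key : ∀ {c e : σ →₀ ℕ}, c ≠ 0 → InRow row i c → c + e ∈ T → InRow row i e := by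
    intro c e hc hci hce
    obtain ⟨j, hj⟩ := hrow _ hce
    obtain rfl := InRow.unique hc hci hj.of_add_left
    exact hj.of_add_right
  intro m hm
  obtain ⟨a', ha', b', hb', rfl⟩ := Set.mem_add.1 hm
  refine InRow.add (key hb0 hi.of_add_right ?_) (key ha0 hi.of_add_left ?_)
  · rw [add_comm]; exact hAB (Set.add_mem_add ha' hb)
  · exact hAB (Set.add_mem_add ha hb')

/-- Every monomial computed at `r` is produced by a multiplication gate with nonconstant factors
whose value is used additively. -/
theorem exists_mul_gate {r : N} (hP : IsProgram layer M)
    (hdeg : ∀ m ∈ M r, 2 ≤ m.degree) (m : σ →₀ ℕ) (n : ℕ) :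
    ∀ v, layer v = n → Used layer M r v 0 → m ∈ M v →
      ∃ v, Used layer M r v 0 ∧ ∃ A B a b, M v = A + B ∧ IsInput layer M (layer v) A ∧
        IsInput layer M (layer v) B ∧ a ∈ A ∧ b ∈ B ∧ a ≠ 0 ∧ b ≠ 0 ∧ m = a + b := by
  induction n using Nat.strong_induction_on with
  | _ n ih =>
  intro v hn hv hm
  have descend : ∀ A, IsInput layer M (layer v) A → A ⊆ M v → m ∈ A →
      ∃ v, Used layer M r v 0 ∧ ∃ A B a b, M v = A + B ∧ IsInput layer M (layer v) A ∧
        IsInput layer M (layer v) B ∧ a ∈ A ∧ b ∈ B ∧ a ≠ 0 ∧ b ≠ 0 ∧ m = a + b := by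
    rintro A (hA | ⟨u, hu, rfl⟩) hAv hmA
    · have := hA m hmA
      have := hdeg m (hv.subset hm)
      omega
    · exact ih _ (by omega) u rfl (hv.of_subset hu hAv) hmA
  obtain ⟨A, B, hA, hB, h | h⟩ := hP v
  · rw [h] at hm
    rcases hm with hm | hm
    · exact descend A hA (h ▸ Set.subset_union_left) hm
    · exact descend B hB (h ▸ Set.subset_union_right) hm
  · obtain ⟨a, ha, b, hb, rfl⟩ := Set.mem_add.1 (h ▸ hm)
    -- If `0 ∈ A`, then `B ⊆ A + B`, so `B` is still used additively and the search for `m`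
    -- continues there.
    by_cases ha0 : a = 0
    · subst ha0
      refine descend B hB ?_ (by simpa using hb)
      intro x hx
      rw [h]
      exact Set.mem_add.2 ⟨0, ha, x, hx, by simp⟩
    by_cases hb0 : b = 0
    · subst hb0
      refine descend A hA ?_ (by simpa using ha)
      intro x hx
      rw [h]
      exact Set.mem_add.2 ⟨x, hx, 0, hb, by simp⟩
    exact ⟨v, hv, A, B, a, b, h, hA, hB, ha, hb, ha0, hb0, rfl⟩

/-- In a program of width `w + 1` all but `w + 1` rows are covered by gates that are computed by
subprograms of width `max w 1`. -/
theorem IsProgram.exists_rows [Finite N] {r : N} (hP : IsProgram layer M) {T : Set (σ →₀ ℕ)}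
    {d w : ℕ} (hd : 2 ≤ d) (hT : M r ⊆ T) (hdeg : ∀ m ∈ T, m.degree = d)
    (hrow : ∀ m ∈ T, ∃ i, InRow row i m) (hw : ∀ t, {v | layer v = t}.ncard ≤ w + 1) :
    ∃ S : Set ρ, S.Finite ∧ S.ncard ≤ w + 1 ∧ ∀ m ∈ M r, ∃ i, InRow row i m ∧
      (i ∈ S ∨ ∃ v, m ∈ M v ∧ M v ⊆ T ∧ (∀ m' ∈ M v, InRow row i m') ∧
        (w = 0 → ∀ m' ∈ M v, m'.degree ≤ 2) ∧
        ∃ N' : Set N, v ∈ N' ∧ IsProgram (fun u : N' => layer u) (fun u : N' => M u) ∧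
          ∀ t, {u : N' | layer u = t}.ncard ≤ max w 1) := by
  classical
  have : Nonempty N := ⟨r⟩
  have hex : ∃ t, ∃ u, layer u = t ∧ Used layer M r u 0 := ⟨_, r, rfl, Used.root⟩
  -- `t₀` is the lowest layer reached additively; every layer from `t₀` up to that of `r` then
  -- contains an additively used node.
  obtain ⟨t₀, ⟨u₀, hu₀, hu₀U⟩, hmin⟩ : ∃ t₀, (∃ u, layer u = t₀ ∧ Used layer M r u 0) ∧
      ∀ u, Used layer M r u 0 → t₀ ≤ layer u :=
    ⟨Nat.find hex, Nat.find_spec hex, fun u hu => Nat.find_min' hex ⟨u, rfl, hu⟩⟩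
  have hfull : ∀ t, t₀ ≤ t → t ≤ layer r → ∃ v, layer v = t ∧ Used layer M r v 0 :=
    fun t h1 h2 => hu₀U.exists_of_le (hu₀.le.trans h1) h2
  -- The exceptional rows: those with a nonconstant monomial just below `t₀`, used under a
  -- nonconstant multiplier.
  let S : Set ρ := {i | ∃ u q, layer u + 1 = t₀ ∧ Used layer M r u q ∧ q ≠ 0 ∧
    ∃ m ∈ M u, m ≠ 0 ∧ InRow row i m}
  have hS : ∀ i ∈ S, ∃ u q, layer u + 1 = t₀ ∧ Used layer M r u q ∧ q ≠ 0 ∧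
    ∃ m ∈ M u, m ≠ 0 ∧ InRow row i m := fun i hi => hi
  choose! f q hf hfU hq m hm hm0 hmi using hS
  have hinj : Set.InjOn f S := by
    -- The nonzero multiplier `q i` is shared by all monomials of the node `f i`, so it forces them
    -- into a single row.
    intro i hi j hj hij
    obtain ⟨i', hi'⟩ := hrow _ (hT ((hfU i hi).add_mem _ (hm i hi)))
    obtain ⟨j', hj'⟩ := hrow _ (hT ((hfU i hi).add_mem _ (hij ▸ hm j hj)))
    rw [InRow.unique (hm0 i hi) (hmi i hi) hi'.of_add_right,
      InRow.unique (hm0 j hj) (hmi j hj) hj'.of_add_right]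
    exact InRow.unique (hq i hi) hi'.of_add_left hj'.of_add_left
  have hmaps : ∀ i ∈ S, f i ∈ {v | layer v = t₀ - 1} := fun i hi => by
    have := hf i hi
    simp only [Set.mem_ofPred_eq]
    omega
  refine ⟨S, Set.Finite.of_injOn hmaps hinj (Set.toFinite _),
    (Set.ncard_le_ncard_of_injOn f hmaps hinj (Set.toFinite _)).trans (hw _), ?_⟩
  clear hmaps hinj hmi hm0 hm hq hfU hf
  intro m hm
  obtain ⟨v, hv, A, B, a, b, hvAB, hA, hB, ha, hb, ha0, hb0, rfl⟩ :=
    exists_mul_gate hP (fun m hm => (hdeg m (hT hm)).symm ▸ hd) m _ r rfl Used.root hm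
  obtain ⟨i, hi⟩ := hrow _ (hT hm)
  refine ⟨i, hi, or_iff_not_imp_left.2 fun hiS => ?_⟩
  have hvT : M v ⊆ T := hv.subset.trans hT
  have hvrow : ∀ m' ∈ M v, InRow row i m' :=
    hvAB ▸ inRow_of_mem_add hrow (hvAB ▸ hvT) ha hb ha0 hb0 hi
  -- The nodes of the smaller program: excluding additively used nodes is what saves one node per
  -- layer.
  let K : Set N := {u | (∃ q, q ≠ 0 ∧ InRow row i q ∧ Used layer M r u q) ∧
    ¬ Used layer M r u 0 ∧ t₀ ≤ layer u ∧ layer u < layer v}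
  have hK : ∀ u q, q ≠ 0 → InRow row i q → Used layer M r u q → layer u < layer v →
      t₀ ≤ layer u + 1 → IsDegreeLEOne (M u) ∨ u ∈ K := by
    intro u q hq hqi hu hlt hle
    -- Used both additively and under `q ≠ 0`, a monomial of `u` would have degree both `d` and `d -
    -- q.degree`. Hence `M u` is empty and free as an input.
    by_cases hu0 : Used layer M r u 0
    · left
      intro m hm
      have h1 := hdeg _ (hT (hu0.subset hm))
      have h2 := hdeg _ (hT (hu.add_mem m hm))
      rw [map_add, h1] at h2
      exact absurd ((Finsupp.degree_eq_zero_iff q).1 (by omega)) hq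
    by_cases hlu : t₀ ≤ layer u
    · exact Or.inr ⟨⟨q, hq, hqi, hu⟩, hu0, hlu, hlt⟩
    -- Here `u` lies just below `t₀`. Since `i ∉ S`, its only possible monomial is `1`, so it is
    -- free as well.
    left
    intro m hm
    by_cases hm0 : m = 0
    · simp [hm0]
    obtain ⟨j, hj⟩ := hrow _ (hT (hu.add_mem m hm))
    obtain rfl := InRow.unique hq hqi hj.of_add_left
    exact absurd ⟨u, q, by omega, hu, hq, m, hm, hm0, hj.of_add_right⟩ hiS
  have hvl := hmin v hv
  have hgate : ∀ A, IsInput layer M (layer v) A → ∀ b, b ≠ 0 → InRow row i b →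
      (∀ a ∈ A, b + a ∈ M v) → IsDegreeLEOne A ∨ ∃ u ∈ K, layer u + 1 = layer v ∧ A = M u := by
    rintro A (hA | ⟨u, hu, rfl⟩) b hb hbi h
    · exact Or.inl hA
    · have := hv.step hu h
      rw [zero_add] at this
      rcases hK u b hb hbi this (by omega) (by omega) with h | h
      · exact Or.inl h
      · exact Or.inr ⟨u, h, hu, rfl⟩
  have hA' := hgate A hA b hb0 hi.of_add_right fun a ha => by
    rw [hvAB, add_comm b]; exact Set.add_mem_add ha hb
  have hB' := hgate B hB a ha0 hi.of_add_left fun b hb => by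
    rw [hvAB]; exact Set.add_mem_add ha hb
  have hKcard : ∀ t, {u ∈ K | layer u = t}.ncard ≤ w := by
    intro t
    by_cases ht : t₀ ≤ t ∧ t ≤ layer r
    · obtain ⟨x, hx, hxU⟩ := hfull t ht.1 ht.2
      -- The additively used node `x` of this layer is not in `K`.
      have : {u ∈ K | layer u = t}.ncard < {u | layer u = t}.ncard := by
        refine Set.ncard_lt_ncard ⟨fun u hu => hu.2, fun h => ?_⟩ (Set.toFinite _)
        exact (h hx).1.2.1 hxU
      have := hw t
      omega
    · have : {u ∈ K | layer u = t} = ∅ := by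
        ext u
        simp only [Set.mem_ofPred_eq, Set.mem_empty_iff_false, iff_false, not_and]
        rintro ⟨⟨q, -, -, hu⟩, -, h1, h2⟩ rfl
        exact ht ⟨h1, hu.layer_le⟩
      simp [this]
  refine ⟨v, hvAB ▸ Set.add_mem_add ha hb, hvT, hvrow, ?_, insert v K, Set.mem_insert _ _, ?_, ?_⟩
  · rintro rfl m' hm'
    have hKe : ∀ u, u ∉ K := fun u hu => by
      have h1 := hKcard (layer u)
      rw [Nat.le_zero, Set.ncard_eq_zero (Set.toFinite _)] at h1
      exact Set.eq_empty_iff_forall_notMem.1 h1 u ⟨hu, rfl⟩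
    rw [hvAB] at hm'
    obtain ⟨a', ha', b', hb', rfl⟩ := Set.mem_add.1 hm'
    have h1 := (hA'.resolve_right fun ⟨u, hu, _⟩ => hKe u hu) a' ha'
    have h2 := (hB'.resolve_right fun ⟨u, hu, _⟩ => hKe u hu) b' hb'
    rw [map_add]
    omega
  · have toInput : ∀ t C, (IsDegreeLEOne C ∨ ∃ u ∈ K, layer u + 1 = t ∧ C = M u) →
        IsInput (fun u : (insert v K : Set N) => layer u)
          (fun u : (insert v K : Set N) => M u) t C := by
      rintro t C (h | ⟨u, hu, h1, h2⟩)
      · exact Or.inl h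
      · exact Or.inr ⟨⟨u, Set.mem_insert_of_mem _ hu⟩, h1, h2⟩
    rintro ⟨u, rfl | hu⟩
    · exact ⟨A, B, toInput _ _ hA', toInput _ _ hB', Or.inr hvAB⟩
    -- Sets of degree at most one, including the empty set, are recomputed from free inputs.
    -- Otherwise a sum gate has nonempty factors, and any element of one serves as multiplier for
    -- the other.
    · by_cases hlin : IsDegreeLEOne (M u)
      · exact ⟨M u, M u, Or.inl hlin, Or.inl hlin, Or.inl (by simp)⟩
      obtain ⟨⟨q, hq, hqi, huU⟩, -, hle, hlt⟩ := hu
      have hstep : ∀ A, IsInput layer M (layer u) A → ∀ b, (∀ a ∈ A, b + a ∈ M u) →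
          IsDegreeLEOne A ∨ ∃ x ∈ K, layer x + 1 = layer u ∧ A = M x := by
        rintro A (hA | ⟨x, hx, rfl⟩) b h
        · exact Or.inl hA
        rcases (M x).eq_empty_or_nonempty with he | ⟨m, hm⟩
        · exact Or.inl fun a ha => by simp [he] at ha
        have hxU := huU.step hx h
        obtain ⟨j, hj⟩ := hrow _ (hT (hxU.add_mem m hm))
        -- The part `q` keeps the longer multiplier `q + b` nonzero and in row `i`.
        obtain rfl := InRow.unique hq hqi hj.of_add_left.of_add_left
        rcases hK x (q + b) (by simp [hq]) hj.of_add_left hxU (by omega) (by omega) with h | h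
        · exact Or.inl h
        · exact Or.inr ⟨x, h, hx, rfl⟩
      obtain ⟨A, B, hA, hB, h | h⟩ := hP u
      · refine ⟨A, B, toInput _ _ (hstep A hA 0 ?_), toInput _ _ (hstep B hB 0 ?_), Or.inl h⟩
        · intro a ha; rw [zero_add, h]; exact Or.inl ha
        · intro a ha; rw [zero_add, h]; exact Or.inr ha
      · obtain ⟨m, hm⟩ : (M u).Nonempty := by
          by_contra hne
          rw [Set.not_nonempty_iff_eq_empty] at hne
          exact hlin fun a ha => by simp [hne] at ha
        obtain ⟨a, ha, b, hb, -⟩ := Set.mem_add.1 (h ▸ hm)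
        refine ⟨A, B, toInput _ _ (hstep A hA b ?_), toInput _ _ (hstep B hB a ?_), Or.inr h⟩
        · intro a' ha'; rw [h, add_comm b]; exact Set.add_mem_add ha' hb
        · intro b' hb'; rw [h]; exact Set.add_mem_add ha hb'
  · intro t
    rw [← Set.ncard_image_of_injective _ Subtype.val_injective]
    -- `K` lies strictly below `v`, so `v` is alone in its layer; this is the `1` in `max w 1`.
    by_cases ht : t = layer v
    · refine le_trans (Set.ncard_le_ncard (t := {v}) ?_) (by simp)
      rintro _ ⟨⟨u, hu⟩, hut, rfl⟩
      rcases hu with rfl | hu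
      · rfl
      · exact absurd hu.2.2.2 (by simp only [Set.mem_ofPred_eq] at hut; omega)
    · refine le_trans (Set.ncard_le_ncard (t := {u ∈ K | layer u = t}) ?_ (Set.toFinite _))
        ((hKcard t).trans (le_max_left _ _))
      rintro _ ⟨⟨u, hu⟩, hut, rfl⟩
      rcases hu with rfl | hu
      · exact absurd hut.symm ht
      · exact ⟨hu, hut⟩

end Rows

/-! ### Supports of polynomials with nonnegative coefficients. -/

section Nonneg

variable {σ : Type*}

/-- The subsemiring of polynomials with nonnegative coefficients. -/
def nonnegCoeffs (σ : Type*) : Subsemiring (MvPolynomial σ ℝ) where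
  carrier := {p | ∀ m, 0 ≤ p.coeff m}
  mul_mem' {p q} hp hq m := by
    classical
    rw [coeff_mul]
    exact Finset.sum_nonneg fun x _ => mul_nonneg (hp _) (hq _)
  one_mem' m := by
    classical
    rw [coeff_one]
    split_ifs <;> norm_num
  add_mem' {p q} hp hq m := by
    rw [coeff_add]
    exact add_nonneg (hp _) (hq _)
  zero_mem' m := by simp

theorem X_mem_nonnegCoeffs (x : σ) : (X x : MvPolynomial σ ℝ) ∈ nonnegCoeffs σ := fun m => by
  classical
  rw [coeff_X]
  split_ifs <;> norm_num

theorem C_mem_nonnegCoeffs {c : ℝ} (hc : 0 ≤ c) :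
    (C c : MvPolynomial σ ℝ) ∈ nonnegCoeffs σ := fun m => by
  classical
  rw [coeff_C]
  split_ifs
  exacts [hc, le_rfl]

theorem support_add_of_nonneg {p q : MvPolynomial σ ℝ} (hp : p ∈ nonnegCoeffs σ)
    (hq : q ∈ nonnegCoeffs σ) :
    ((p + q).support : Set (σ →₀ ℕ)) = (p.support : Set (σ →₀ ℕ)) ∪ q.support := by
  ext m
  have h1 := hp m
  have h2 := hq m
  simp only [Finset.mem_coe, mem_support_iff, coeff_add, Set.mem_union, ne_eq,
    add_eq_zero_iff_of_nonneg h1 h2, not_and_or]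

theorem support_mul_of_nonneg {p q : MvPolynomial σ ℝ} (hp : p ∈ nonnegCoeffs σ)
    (hq : q ∈ nonnegCoeffs σ) :
    ((p * q).support : Set (σ →₀ ℕ)) = (p.support : Set (σ →₀ ℕ)) + q.support := by
  classical
  ext m
  rw [Finset.mem_coe, mem_support_iff, coeff_mul, Ne,
    Finset.sum_eq_zero_iff_of_nonneg fun x _ => mul_nonneg (hp _) (hq _), Set.mem_add]
  simp only [mul_eq_zero, not_forall, not_or, Finset.mem_coe, mem_support_iff]
  constructor
  · rintro ⟨⟨a, b⟩, h, ha, hb⟩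
    exact ⟨a, ha, b, hb, Finset.HasAntidiagonal.mem_antidiagonal.1 h⟩
  · rintro ⟨a, ha, b, hb, h⟩
    exact ⟨(a, b), Finset.HasAntidiagonal.mem_antidiagonal.2 h, ha, hb⟩

theorem mem_support_sum_of_nonneg {ι : Type*} {s : Finset ι} {p : ι → MvPolynomial σ ℝ}
    (hp : ∀ i ∈ s, p i ∈ nonnegCoeffs σ) {m : σ →₀ ℕ} :
    m ∈ (∑ i ∈ s, p i).support ↔ ∃ i ∈ s, m ∈ (p i).support := by
  simp only [mem_support_iff, coeff_sum, Ne,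
    Finset.sum_eq_zero_iff_of_nonneg fun i hi => hp i hi m, not_forall, exists_prop]

theorem support_prod_of_nonneg {ι : Type*} {s : Finset ι} {p : ι → MvPolynomial σ ℝ}
    (hp : ∀ i ∈ s, p i ∈ nonnegCoeffs σ) :
    ((∏ i ∈ s, p i).support : Set (σ →₀ ℕ)) = ∑ i ∈ s, ((p i).support : Set (σ →₀ ℕ)) := by
  classical
  induction s using Finset.induction_on with
  | empty => simpa [support_one] using Set.singleton_zero
  | insert a s ha ih =>
    rw [Finset.prod_insert ha, Finset.sum_insert ha, support_mul_of_nonneg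
      (hp _ (Finset.mem_insert_self _ _))
      (prod_mem fun i hi => hp i (Finset.mem_insert_of_mem hi)),
      ih fun i hi => hp i (Finset.mem_insert_of_mem hi)]

theorem rename_mem_nonnegCoeffs {τ : Type*} {f : σ → τ} (hf : Function.Injective f)
    {p : MvPolynomial σ ℝ} (hp : p ∈ nonnegCoeffs σ) : rename f p ∈ nonnegCoeffs τ := fun m => by
  by_cases h : ∃ u : σ →₀ ℕ, u.mapDomain f = m
  · obtain ⟨u, rfl⟩ := h
    rw [coeff_rename_mapDomain f hf]
    exact hp u
  · rw [coeff_rename_eq_zero f p m fun u hu => absurd ⟨u, hu⟩ h]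

end Nonneg

/-! ### Rows, blocks and monomials of the alternating polynomial. -/

section AltPoly

variable (ℓ k : ℕ)

theorem blockIndex_injective :
    Function.Injective fun p : Fin ℓ × Fin ℓ × Fin (ℓ ^ (2 * k)) =>
      blockIndex ℓ k p.1 p.2.1 p.2.2 := by
  rintro ⟨i, j, v⟩ ⟨i', j', v'⟩ h
  have h : (i : ℕ) * ℓ ^ (2 * k + 1) + j * ℓ ^ (2 * k) + v =
      i' * ℓ ^ (2 * k + 1) + j' * ℓ ^ (2 * k) + v' := congrArg Fin.val h
  have hb : 0 < ℓ ^ (2 * k) := v.pos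
  -- Row, block and position are mixed-radix digits, recovered by division with remainder.
  have e : ∀ a b c : ℕ, a * ℓ ^ (2 * k + 1) + b * ℓ ^ (2 * k) + c =
      c + ℓ ^ (2 * k) * (b + ℓ * a) := fun a b c => by ring
  rw [e, e] at h
  have hv := congrArg (· % ℓ ^ (2 * k)) h
  have hq := congrArg (· / ℓ ^ (2 * k)) h
  simp only [Nat.add_mul_mod_self_left, Nat.mod_eq_of_lt v.2, Nat.mod_eq_of_lt v'.2] at hv
  simp only [Nat.add_mul_div_left _ _ hb, Nat.div_eq_of_lt v.2, Nat.div_eq_of_lt v'.2,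
    zero_add] at hq
  have hj := congrArg (· % ℓ) hq
  have hi := congrArg (· / ℓ) hq
  simp only [Nat.add_mul_mod_self_left, Nat.mod_eq_of_lt j.2, Nat.mod_eq_of_lt j'.2] at hj
  simp only [Nat.add_mul_div_left _ _ i.pos, Nat.div_eq_of_lt j.2, Nat.div_eq_of_lt j'.2,
    zero_add] at hi
  rw [Fin.ext hv, Fin.ext hj, Fin.ext hi]

/-- The positions of the variables of `altPoly ℓ (k + 1)` as triples of row, block and position
within the block. -/
noncomputable def blockEquiv :
    Fin ℓ × Fin ℓ × Fin (ℓ ^ (2 * k)) ≃ Fin (ℓ ^ (2 * (k + 1))) :=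
  Equiv.ofBijective _ ((Fintype.bijective_iff_injective_and_card _).2
    ⟨blockIndex_injective ℓ k, by simp only [Fintype.card_prod, Fintype.card_fin]; ring⟩)

/-- The row of a variable of `altPoly ℓ (k + 1)`. -/
noncomputable def blockRow (y : Fin (ℓ ^ (2 * (k + 1)))) : Fin ℓ :=
  ((blockEquiv ℓ k).symm y).1

variable {ℓ k}

theorem blockRow_blockIndex (i j : Fin ℓ) (x : Fin (ℓ ^ (2 * k))) :
    blockRow ℓ k (blockIndex ℓ k i j x) = i :=
  congrArg Prod.fst ((blockEquiv ℓ k).symm_apply_apply (i, j, x))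

theorem exists_blockIndex (y : Fin (ℓ ^ (2 * (k + 1)))) :
    ∃ i j x, y = blockIndex ℓ k i j x :=
  let p := (blockEquiv ℓ k).symm y
  ⟨p.1, p.2.1, p.2.2, ((blockEquiv ℓ k).apply_symm_apply y).symm⟩

theorem blockIndex_block_injective (i j : Fin ℓ) : Function.Injective (blockIndex ℓ k i j) :=
  fun x y h => by
    simpa using blockIndex_injective ℓ k (a₁ := (i, j, x)) (a₂ := (i, j, y)) h

/-- The monomial of row `i` with given restrictions to the blocks. -/
noncomputable def blockMonomial (i : Fin ℓ) (g : Fin ℓ → Fin (ℓ ^ (2 * k)) →₀ ℕ) :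
    Fin (ℓ ^ (2 * (k + 1))) →₀ ℕ :=
  ∑ j, (g j).mapDomain (blockIndex ℓ k i j)

theorem blockMonomial_apply (i i' j : Fin ℓ) (g : Fin ℓ → Fin (ℓ ^ (2 * k)) →₀ ℕ)
    (x : Fin (ℓ ^ (2 * k))) :
    blockMonomial i g (blockIndex ℓ k i' j x) = if i = i' then g j x else 0 := by
  classical
  have hne : ∀ j', (i, j') ≠ (i', j) →
      (g j').mapDomain (blockIndex ℓ k i j') (blockIndex ℓ k i' j x) = 0 := fun j' h =>
    Finsupp.mapDomain_of_notMem_range _ _ fun ⟨y, hy⟩ => h <| by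
      have := blockIndex_injective ℓ k (a₁ := (i, j', y)) (a₂ := (i', j, x)) hy
      simp only [Prod.mk.injEq] at this ⊢
      exact ⟨this.1, this.2.1⟩
  rw [blockMonomial, Finsupp.finsetSum_apply]
  split_ifs with h
  · subst h
    rw [Finset.sum_eq_single j (fun j' _ h => hne j' (by simpa using h)) (by simp),
      Finsupp.mapDomain_apply (blockIndex_block_injective i j)]
  · exact Finset.sum_eq_zero fun j' _ => hne j' fun e => h (congrArg Prod.fst e)

theorem inRow_blockMonomial (i : Fin ℓ) (g : Fin ℓ → Fin (ℓ ^ (2 * k)) →₀ ℕ) :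
    InRow (blockRow ℓ k) i (blockMonomial i g) := by
  intro y hy
  obtain ⟨i', j, x, rfl⟩ := exists_blockIndex y
  rw [blockMonomial_apply] at hy
  rw [blockRow_blockIndex]
  by_contra h
  exact hy (if_neg (Ne.symm h))

/-- The restriction of monomials to a block. -/
noncomputable def blockProj (i j : Fin ℓ) :
    (Fin (ℓ ^ (2 * (k + 1))) →₀ ℕ) →+ (Fin (ℓ ^ (2 * k)) →₀ ℕ) :=
  Finsupp.comapDomain.addMonoidHom (blockIndex_block_injective i j)

theorem blockProj_blockMonomial (i j : Fin ℓ) (g : Fin ℓ → Fin (ℓ ^ (2 * k)) →₀ ℕ) :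
    blockProj i j (blockMonomial i g) = g j := by
  ext x
  exact (blockMonomial_apply i i j g x).trans (if_pos rfl)

theorem degree_blockProj_le (i j : Fin ℓ) (m : Fin (ℓ ^ (2 * (k + 1))) →₀ ℕ) :
    (blockProj i j m).degree ≤ m.degree :=
  Finsupp.degree_comapDomain_le_of_canonicallyOrderedAdd _

variable (ℓ k) in
theorem altPoly_mem_nonnegCoeffs : altPoly ℓ k ∈ nonnegCoeffs (Fin (ℓ ^ (2 * k))) := by
  induction k with
  | zero => exact X_mem_nonnegCoeffs _
  | succ k ih =>
    exact sum_mem fun i _ => prod_mem fun j _ =>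
      rename_mem_nonnegCoeffs (blockIndex_block_injective i j) ih

theorem mem_support_altPoly_succ {m : Fin (ℓ ^ (2 * (k + 1))) →₀ ℕ} :
    m ∈ (altPoly ℓ (k + 1)).support ↔
      ∃ i, ∃ g : Fin ℓ → Fin (ℓ ^ (2 * k)) →₀ ℕ, (∀ j, g j ∈ (altPoly ℓ k).support) ∧
        m = blockMonomial i g := by
  classical
  have hr : ∀ i j, rename (blockIndex ℓ k i j) (altPoly ℓ k) ∈ nonnegCoeffs _ := fun i j =>
    rename_mem_nonnegCoeffs (blockIndex_block_injective i j) (altPoly_mem_nonnegCoeffs ℓ k)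
  rw [altPoly, mem_support_sum_of_nonneg fun i _ => prod_mem fun j _ => hr i j]
  simp only [Finset.mem_univ, true_and]
  refine exists_congr fun i => ?_
  rw [← Finset.mem_coe, support_prod_of_nonneg fun j _ => hr i j, Set.mem_fintype_sum]
  simp only [Finset.mem_coe, support_rename_of_injective (blockIndex_block_injective i _),
    Finset.mem_image]
  constructor
  · rintro ⟨g, hg, rfl⟩
    choose h hh hhg using hg
    exact ⟨h, hh, by simp only [blockMonomial, hhg]⟩
  · rintro ⟨g, hg, rfl⟩
    exact ⟨_, fun j => ⟨g j, hg j, rfl⟩, rfl⟩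

theorem degree_of_mem_support_altPoly {m : Fin (ℓ ^ (2 * k)) →₀ ℕ}
    (hm : m ∈ (altPoly ℓ k).support) : m.degree = ℓ ^ k := by
  induction k with
  | zero =>
    rw [altPoly, support_X, Finset.mem_singleton] at hm
    rw [hm, Finsupp.degree_single, pow_zero]
  | succ k ih =>
    obtain ⟨i, g, hg, rfl⟩ := mem_support_altPoly_succ.1 hm
    simp [blockMonomial, map_sum, Finsupp.degree_mapDomain, ih (hg _), pow_succ']

theorem ne_zero_of_mem_support_altPoly (hℓ : 0 < ℓ) {m : Fin (ℓ ^ (2 * k)) →₀ ℕ}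
    (hm : m ∈ (altPoly ℓ k).support) : m ≠ 0 := by
  rintro rfl
  have := degree_of_mem_support_altPoly hm
  rw [map_zero] at this
  exact (pow_pos hℓ k).ne this

theorem exists_inRow_of_mem_support_altPoly {m : Fin (ℓ ^ (2 * (k + 1))) →₀ ℕ}
    (hm : m ∈ (altPoly ℓ (k + 1)).support) : ∃ i, InRow (blockRow ℓ k) i m := by
  obtain ⟨i, g, -, rfl⟩ := mem_support_altPoly_succ.1 hm
  exact ⟨i, inRow_blockMonomial i g⟩

/-- A monomial of row `i` is determined by its restrictions to the blocks. -/
theorem exists_eq_blockMonomial {m : Fin (ℓ ^ (2 * (k + 1))) →₀ ℕ}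
    (hm : m ∈ (altPoly ℓ (k + 1)).support) {i : Fin ℓ} (hi : InRow (blockRow ℓ k) i m) :
    (∀ j, blockProj i j m ∈ (altPoly ℓ k).support) ∧
      m = blockMonomial i fun j => blockProj i j m := by
  have hm0 := ne_zero_of_mem_support_altPoly i.pos hm
  obtain ⟨i', g, hg, rfl⟩ := mem_support_altPoly_succ.1 hm
  obtain rfl := InRow.unique hm0 (inRow_blockMonomial i' g) hi
  simp only [blockProj_blockMonomial]
  exact ⟨hg, trivial⟩

theorem card_support_altPoly_succ (hℓ : 0 < ℓ) :
    (altPoly ℓ (k + 1)).support.card = ℓ * (altPoly ℓ k).support.card ^ ℓ := by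
  classical
  have himg : (altPoly ℓ (k + 1)).support =
      (Finset.univ ×ˢ Fintype.piFinset fun _ : Fin ℓ => (altPoly ℓ k).support).image
        fun p => blockMonomial p.1 p.2 := by
    ext m
    simp only [mem_support_altPoly_succ, Finset.mem_image, Finset.mem_product, Finset.mem_univ,
      true_and, Fintype.mem_piFinset, Prod.exists]
    exact exists_congr fun i => exists_congr fun g => and_congr_right fun _ => eq_comm
  rw [himg, Finset.card_image_of_injOn, Finset.card_product, Fintype.card_piFinset_const,
    Finset.card_univ, Fintype.card_fin]
  rintro ⟨i, g⟩ hg ⟨i', g'⟩ - h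
  simp only [Finset.coe_product, Set.mem_prod, Finset.mem_coe, Fintype.mem_piFinset] at hg h
  have hm : blockMonomial i g ∈ (altPoly ℓ (k + 1)).support :=
    mem_support_altPoly_succ.2 ⟨i, g, hg.2, rfl⟩
  obtain rfl := InRow.unique (ne_zero_of_mem_support_altPoly hℓ hm) (inRow_blockMonomial i g)
    (h ▸ inRow_blockMonomial i' g')
  rw [Prod.mk.injEq]
  refine ⟨rfl, funext fun j => ?_⟩
  rw [← blockProj_blockMonomial i j g, h, blockProj_blockMonomial]

theorem card_support_altPoly_pos (hℓ : 0 < ℓ) : 0 < (altPoly ℓ k).support.card := by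
  induction k with
  | zero => simp [altPoly, support_X]
  | succ k ih => rw [card_support_altPoly_succ hℓ]; positivity

end AltPoly

/-! ### Counting monomials and the induction on the width. -/

section Counting

variable {ℓ k : ℕ}

/-- Additive maps commute with unions and Minkowski sums, and not raising degrees keeps free inputs
free. It serves to restrict a program to a block without changing its width. -/
theorem IsProgram.image {N σ τ : Type*} {layer : N → ℕ} {M : N → Set (σ →₀ ℕ)}
    (hP : IsProgram layer M) (π : (σ →₀ ℕ) →+ (τ →₀ ℕ)) (hπ : ∀ m, (π m).degree ≤ m.degree) :
    IsProgram layer fun v => π '' M v := by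
  have key : ∀ t A, IsInput layer M t A → IsInput layer (fun v => π '' M v) t (π '' A) := by
    rintro t A (hA | ⟨u, hu, rfl⟩)
    · refine Or.inl ?_
      rintro _ ⟨a, ha, rfl⟩
      exact (hπ a).trans (hA a ha)
    · exact Or.inr ⟨u, hu, rfl⟩
  intro v
  obtain ⟨A, B, hA, hB, h | h⟩ := hP v
  · exact ⟨_, _, key _ _ hA, key _ _ hB, Or.inl (by simp only [h, Set.image_union])⟩
  · exact ⟨_, _, key _ _ hA, key _ _ hB, Or.inr (by simp only [h, Set.image_add])⟩

/-- A set of monomials of a single row that covers less than half of each block is small. -/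
theorem two_pow_mul_ncard_le {A : Set (Fin (ℓ ^ (2 * (k + 1))) →₀ ℕ)} {i : Fin ℓ}
    (hA : A ⊆ (altPoly ℓ (k + 1)).support) (hi : ∀ m ∈ A, InRow (blockRow ℓ k) i m)
    (hsmall : ∀ j, 2 * (blockProj i j '' A).ncard ≤ (altPoly ℓ k).support.card) :
    2 ^ ℓ * A.ncard ≤ (altPoly ℓ k).support.card ^ ℓ := by
  classical
  have hfin : A.Finite := (Finset.finite_toSet _).subset hA
  lift A to Finset (Fin (ℓ ^ (2 * (k + 1))) →₀ ℕ) using hfin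
  -- Within a row a monomial is determined by its block restrictions, so `A` embeds into the product
  -- of its projections.
  have hle : A.card ≤ ∏ j, (A.image (blockProj i j)).card := by
    rw [← Fintype.card_piFinset]
    refine Finset.card_le_card_of_injOn (fun m j => blockProj i j m) ?_ ?_
    · intro m hm
      exact Finset.mem_coe.2 <| Fintype.mem_piFinset.2 fun j => Finset.mem_image_of_mem _ hm
    · intro m hm m' hm' h
      rw [(exists_eq_blockMonomial (hA hm) (hi m hm)).2,
        (exists_eq_blockMonomial (hA hm') (hi m' hm')).2]
      exact congrArg _ h
  rw [Set.ncard_coe_finset]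
  calc 2 ^ ℓ * A.card ≤ 2 ^ ℓ * ∏ j, (A.image (blockProj i j)).card := by gcongr
    _ = ∏ j, 2 * (A.image (blockProj i j)).card := by simp [Finset.prod_mul_distrib]
    _ ≤ ∏ _j : Fin ℓ, (altPoly ℓ k).support.card := by
      refine Finset.prod_le_prod' fun j _ => ?_
      rw [← Set.ncard_coe_finset, Finset.coe_image]
      exact hsmall j
    _ = (altPoly ℓ k).support.card ^ ℓ := by simp

theorem ncard_row_le {A : Set (Fin (ℓ ^ (2 * (k + 1))) →₀ ℕ)} {i : Fin ℓ}
    (hA : A ⊆ (altPoly ℓ (k + 1)).support) (hi : ∀ m ∈ A, InRow (blockRow ℓ k) i m) :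
    A.ncard ≤ (altPoly ℓ k).support.card ^ ℓ := by
  have hcard := Fintype.card_piFinset_const (altPoly ℓ k).support ℓ
  rw [← hcard, ← Set.ncard_coe_finset]
  refine Set.ncard_le_ncard_of_injOn (fun m j => blockProj i j m) ?_ ?_ (Finset.finite_toSet _)
  · intro m hm
    exact Finset.mem_coe.2 <| Fintype.mem_piFinset.2
      (exists_eq_blockMonomial (hA hm) (hi m hm)).1
  · intro m hm m' hm' h
    rw [(exists_eq_blockMonomial (hA hm) (hi m hm)).2,
      (exists_eq_blockMonomial (hA hm') (hi m' hm')).2]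
    exact congrArg _ h

/-- A set covered by few rows and few small sets contains less than half of the monomials. -/
theorem two_mul_ncard_lt_of_cover {N : Type*} [Finite N] (hℓ : 2 * k + 3 < ℓ)
    (hN : 10 * Nat.card N < 2 ^ ℓ) {A : Set (Fin (ℓ ^ (2 * (k + 1))) →₀ ℕ)}
    (hA : A ⊆ (altPoly ℓ (k + 1)).support) {S : Set (Fin ℓ)} (hS : S.ncard ≤ k + 1)
    (M : N → Set (Fin (ℓ ^ (2 * (k + 1))) →₀ ℕ))
    (hcover : ∀ m ∈ A, (∃ i ∈ S, InRow (blockRow ℓ k) i m) ∨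
      ∃ v, m ∈ M v ∧ 2 ^ ℓ * (A ∩ M v).ncard ≤ (altPoly ℓ k).support.card ^ ℓ) :
    2 * A.ncard < (altPoly ℓ (k + 1)).support.card := by
  classical
  have := Fintype.ofFinite N
  have hfin : A.Finite := (Finset.finite_toSet _).subset hA
  have ht := card_support_altPoly_pos (k := k) (show 0 < ℓ by omega)
  rw [card_support_altPoly_succ (by omega)]
  set t := (altPoly ℓ k).support.card ^ ℓ with ht'
  have ht0 : 0 < t := by positivity
  set V : Finset N := Finset.univ.filter fun v => 2 ^ ℓ * (A ∩ M v).ncard ≤ t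
  set B : Set (Fin (ℓ ^ (2 * (k + 1))) →₀ ℕ) :=
    ⋃ i ∈ S.toFinset, {m ∈ A | InRow (blockRow ℓ k) i m}
  set D : Set (Fin (ℓ ^ (2 * (k + 1))) →₀ ℕ) := ⋃ v ∈ V, A ∩ M v
  have hBA : B ⊆ A := Set.iUnion₂_subset fun i _ m hm => hm.1
  have hDA : D ⊆ A := Set.iUnion₂_subset fun v _ m hm => hm.1
  have hBD : A ⊆ B ∪ D := by
    intro m hm
    rcases hcover m hm with ⟨i, hi, hmi⟩ | ⟨v, hmv, hv⟩
    · exact Or.inl (Set.mem_iUnion₂.2 ⟨i, Set.mem_toFinset.2 hi, hm, hmi⟩)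
    · exact Or.inr (Set.mem_iUnion₂.2 ⟨v, by simpa [V] using hv, hm, hmv⟩)
  have hB : B.ncard ≤ (k + 1) * t := by
    refine (Finset.set_ncard_biUnion_le _ _).trans ((Finset.sum_le_card_nsmul _ _ t
      fun i _ => ncard_row_le (fun m hm => hA hm.1) fun m hm => hm.2).trans ?_)
    rw [smul_eq_mul, ← Set.ncard_eq_toFinset_card']
    gcongr
  have hD : 10 * (2 ^ ℓ * D.ncard) ≤ 2 ^ ℓ * t := by
    calc 10 * (2 ^ ℓ * D.ncard) ≤ 10 * (2 ^ ℓ * ∑ v ∈ V, (A ∩ M v).ncard) := by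
          gcongr; exact Finset.set_ncard_biUnion_le _ _
      _ = 10 * ∑ v ∈ V, 2 ^ ℓ * (A ∩ M v).ncard := by rw [Finset.mul_sum]
      _ ≤ 10 * (V.card * t) := by
          gcongr
          exact Finset.sum_le_card_nsmul _ _ t fun v hv => (Finset.mem_filter.1 hv).2
      _ ≤ 10 * (Nat.card N * t) := by
          gcongr; rw [Nat.card_eq_fintype_card]; exact Finset.card_le_univ _
      _ = 10 * Nat.card N * t := by ring
      _ ≤ 2 ^ ℓ * t := by gcongr
  have hD' : 10 * D.ncard ≤ t := by
    refine Nat.le_of_mul_le_mul_left (c := 2 ^ ℓ) ?_ (by positivity)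
    linarith
  have hAcard : A.ncard ≤ B.ncard + D.ncard :=
    (Set.ncard_le_ncard hBD ((hfin.subset hBA).union (hfin.subset hDA))).trans
      (Set.ncard_union_le _ _)
  -- Twice the covered part is at most `(2 * (k + 1) + 1/5) * t`, which is less than `(2 * k + 4) *
  -- t`.
  have hlt : (2 * k + 4) * t ≤ ℓ * t := by gcongr; omega
  nlinarith

/-- Programs of width at most `k + 1` with fewer than `2 ^ ℓ / 10` nodes compute less than half of
the monomials of `altPoly ℓ (k + 1)`. -/
theorem IsProgram.two_mul_ncard_lt (hℓ : 2 * k + 3 < ℓ) {N : Type*} [Finite N] {layer : N → ℕ}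
    {M : N → Set (Fin (ℓ ^ (2 * (k + 1))) →₀ ℕ)} (hP : IsProgram layer M)
    (hw : ∀ t, {v | layer v = t}.ncard ≤ k + 1) (hN : 10 * Nat.card N < 2 ^ ℓ) (r : N)
    (hr : M r ⊆ (altPoly ℓ (k + 1)).support) :
    2 * (M r).ncard < (altPoly ℓ (k + 1)).support.card := by
  induction k generalizing N with
  | zero =>
    obtain ⟨S, -, hS, h⟩ := hP.exists_rows (d := ℓ ^ (0 + 1)) (by rw [zero_add, pow_one]; omega) hr
      (fun m hm => degree_of_mem_support_altPoly hm)
      (fun m hm => exists_inRow_of_mem_support_altPoly hm) hw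
    refine two_mul_ncard_lt_of_cover hℓ hN hr hS M fun m hm => ?_
    obtain ⟨i, hi, hiS | ⟨v, hmv, hvT, -, hdeg, -⟩⟩ := h m hm
    · exact Or.inl ⟨i, hiS, hi⟩
    -- In width one the gate has degree at most two, while `m` has degree `ℓ > 3`: only exceptional
    -- rows occur.
    · have h1 := hdeg rfl m hmv
      have h2 := degree_of_mem_support_altPoly (hvT hmv)
      have h3 : ℓ ^ (0 + 1) = ℓ := by rw [zero_add, pow_one]
      omega
  | succ k ih =>
    have hd : 2 ≤ ℓ ^ (k + 1 + 1) := by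
      calc 2 ≤ ℓ := by omega
        _ ≤ ℓ ^ (k + 1 + 1) := Nat.le_self_pow (by omega) ℓ
    obtain ⟨S, -, hS, h⟩ := hP.exists_rows hd hr
      (fun m hm => degree_of_mem_support_altPoly hm)
      (fun m hm => exists_inRow_of_mem_support_altPoly hm) hw
    refine two_mul_ncard_lt_of_cover hℓ hN hr hS M fun m hm => ?_
    obtain ⟨i, hi, hiS | ⟨v, hmv, hvT, hvi, -, N', hvN, hP', hw'⟩⟩ := h m hm
    · exact Or.inl ⟨i, hiS, hi⟩
    refine Or.inr ⟨v, hmv, le_trans ?_ (two_pow_mul_ncard_le hvT hvi fun j => ?_)⟩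
    · gcongr
      exacts [(Finset.finite_toSet _).subset hvT, Set.inter_subset_right]
    -- The induction hypothesis is applied to the subprogram restricted to block `j`; its width is
    -- at most `max (k + 1) 1 = k + 1`.
    · refine (ih (by omega) (hP'.image (blockProj i j) (degree_blockProj_le i j))
        (fun t => (hw' t).trans (by simp)) (lt_of_le_of_lt ?_ hN) ⟨v, hvN⟩ ?_).le
      · gcongr
        exact Nat.card_le_card_of_injective _ Subtype.val_injective
      · rintro _ ⟨m', hm', rfl⟩
        exact (exists_eq_blockMonomial (hvT hm') (hvi m' hm')).1 j

end Counting

/-! ### From monotone circuits to set programs, and the size bound. -/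

namespace LayeredCircuit

variable {σ : Type*} {C : LayeredCircuit ℝ σ}

theorem layerCard_le_width {t : ℕ} (ht : 2 ≤ t) : C.layerCard t ≤ C.width := by
  by_cases h : t ≤ C.lastLayer
  · exact Finset.le_sup (f := C.layerCard) (Finset.mem_Icc.2 ⟨ht, h⟩)
  · rw [layerCard, Finset.card_eq_zero.2]
    · exact Nat.zero_le _
    · refine Finset.filter_eq_empty_iff.2 fun v _ hv => h ?_
      exact hv ▸ Finset.le_sup (f := C.layer) (Finset.mem_univ v)

theorem IsMonotone.nodePoly_mem (hC : C.IsMonotone) (n : ℕ) :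
    ∀ v, C.layer v = n → C.nodePoly v ∈ nonnegCoeffs σ := by
  induction n using Nat.strong_induction_on with
  | _ n ih =>
  rintro v rfl
  cases h : C.label v with
  | var x => exact C.nodePoly_var h ▸ X_mem_nonnegCoeffs x
  | const c => exact C.nodePoly_const h ▸ C_mem_nonnegCoeffs (hC v c h)
  | add u w =>
    exact C.nodePoly_add h ▸ add_mem (ih _ (C.layer_lt (by simp [h, NodeLabel.children])) u rfl)
      (ih _ (C.layer_lt (by simp [h, NodeLabel.children])) w rfl)
  | mul u w =>
    exact C.nodePoly_mul h ▸ mul_mem (ih _ (C.layer_lt (by simp [h, NodeLabel.children])) u rfl)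
      (ih _ (C.layer_lt (by simp [h, NodeLabel.children])) w rfl)

theorem isDegreeLEOne_of_leaf {v : C.Node} (h : (C.label v).children = []) :
    IsDegreeLEOne ((C.nodePoly v).support : Set (σ →₀ ℕ)) := by
  intro m hm
  cases hv : C.label v with
  | var x =>
    rw [C.nodePoly_var hv, Finset.mem_coe, support_X, Finset.mem_singleton] at hm
    rw [hm, Finsupp.degree_single]
  | const c =>
    classical
    rw [C.nodePoly_const hv, Finset.mem_coe, mem_support_iff, coeff_C] at hm
    rw [← (ite_ne_right_iff.1 hm).1, map_zero]
    exact Nat.zero_le _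
  | add u w => simp [hv, NodeLabel.children] at h
  | mul u w => simp [hv, NodeLabel.children] at h

/-- The sets of monomials at the nodes outside the first layer of a monotone circuit. -/
theorem IsMonotone.isProgram (hC : C.IsMonotone) :
    IsProgram (fun v : {v : C.Node // 2 ≤ C.layer v} => C.layer v)
      fun v => ((C.nodePoly v).support : Set (σ →₀ ℕ)) := by
  rintro ⟨v, hv⟩
  have hin : ∀ u ∈ (C.label v).children,
      IsInput (fun v : {v : C.Node // 2 ≤ C.layer v} => C.layer v)
        (fun v => ((C.nodePoly v).support : Set (σ →₀ ℕ))) (C.layer v)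
        (C.nodePoly u).support := by
    intro u hu
    by_cases h1 : C.layer u = 1
    · exact Or.inl (isDegreeLEOne_of_leaf (C.leaf_of_layer_eq_one u h1))
    · have := C.one_le_layer u
      exact Or.inr ⟨⟨u, by omega⟩, (C.layer_child v u hu).resolve_left h1, rfl⟩
  by_cases hleaf : (C.label v).children = []
  · exact ⟨_, _, Or.inl (isDegreeLEOne_of_leaf hleaf), Or.inl (isDegreeLEOne_of_leaf hleaf),
      Or.inl (Set.union_self _).symm⟩
  cases h : C.label v with
  | var x => exact absurd (by simp [h, NodeLabel.children]) hleaf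
  | const c => exact absurd (by simp [h, NodeLabel.children]) hleaf
  | add u w =>
    refine ⟨_, _, hin u (by simp [h, NodeLabel.children]), hin w (by simp [h, NodeLabel.children]),
      Or.inl ?_⟩
    simp only [C.nodePoly_add h]
    exact support_add_of_nonneg (hC.nodePoly_mem _ u rfl) (hC.nodePoly_mem _ w rfl)
  | mul u w =>
    refine ⟨_, _, hin u (by simp [h, NodeLabel.children]), hin w (by simp [h, NodeLabel.children]),
      Or.inr ?_⟩
    simp only [C.nodePoly_mul h]
    exact support_mul_of_nonneg (hC.nodePoly_mem _ u rfl) (hC.nodePoly_mem _ w rfl)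

theorem IsMonotone.two_pow_le_size {ℓ k : ℕ} (hℓ : 2 * k + 3 < ℓ)
    {C : LayeredCircuit ℝ (Fin (ℓ ^ (2 * (k + 1))))} (hC : C.IsMonotone) (hw : C.width ≤ k + 1)
    (hsub : C.poly.support ⊆ (altPoly ℓ (k + 1)).support)
    (hcard : (altPoly ℓ (k + 1)).support.card ≤ 2 * C.poly.support.card) :
    2 ^ ℓ ≤ 10 * C.size := by
  by_contra! hsize
  -- The program omits the first layer, since width does not count it. An output there would be a
  -- leaf of degree at most one, too small for degree `ℓ ^ (k + 1)`.
  by_cases hout : C.layer C.output = 1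
  · have hpos := card_support_altPoly_pos (ℓ := ℓ) (k := k + 1) (by omega)
    obtain ⟨m, hm⟩ := Finset.card_pos.1 (show 0 < C.poly.support.card by omega)
    have h1 := isDegreeLEOne_of_leaf (C.leaf_of_layer_eq_one _ hout) m hm
    have h2 := degree_of_mem_support_altPoly (hsub hm)
    have h3 : ℓ ≤ ℓ ^ (k + 1) := Nat.le_self_pow (by omega) ℓ
    omega
  have hout' := C.one_le_layer C.output
  have h := hC.isProgram.two_mul_ncard_lt hℓ (fun t => ?_) (lt_of_le_of_lt ?_ hsize)
    ⟨C.output, by omega⟩ (Finset.coe_subset.2 hsub)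
  · rw [Set.ncard_coe_finset] at h
    exact absurd hcard (not_le.2 h)
  · rw [← Set.ncard_image_of_injective _ Subtype.val_injective]
    by_cases ht : 2 ≤ t
    · refine le_trans ?_ ((layerCard_le_width ht).trans hw)
      rw [layerCard, ← Set.ncard_coe_finset]
      refine Set.ncard_le_ncard ?_ (Set.toFinite _)
      rintro _ ⟨v, hv, rfl⟩
      exact Finset.mem_coe.2 (Finset.mem_filter.2 ⟨Finset.mem_univ _, hv⟩)
    · rw [(Set.ncard_eq_zero (Set.toFinite _)).2]
      · exact Nat.zero_le _
      · rw [Set.image_eq_empty, Set.eq_empty_iff_forall_notMem]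
        rintro ⟨v, hv⟩ rfl
        exact ht hv
  · gcongr
    rw [size, ← Nat.card_eq_fintype_card]
    exact Nat.card_le_card_of_injective _ Subtype.val_injective

end LayeredCircuit

theorem mainTheorem1 (k : ℕ) (hk : 0 < k) :
    ∃ ℓ₀ : ℕ, 0 < ℓ₀ ∧ ∀ ℓ : ℕ, ℓ₀ < ℓ →
      (∀ C : LayeredCircuit ℝ (Fin (ℓ ^ (2 * k))), C.IsMonotone → C.width ≤ k →
        C.poly.support ⊆ (altPoly ℓ k).support →
        ((altPoly ℓ k).support.card : ℝ) / 2 ≤ (C.poly.support.card : ℝ) →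
        (2 : ℝ) ^ ℓ / 10 ≤ (C.size : ℝ)) ∧
      (∀ C : LayeredCircuit ℝ (Fin (ℓ ^ (2 * k))), C.IsMonotone → C.width ≤ k →
        C.poly = altPoly ℓ k →
        (2 : ℝ) ^ ℓ / 10 ≤ (C.size : ℝ)) := by
  obtain ⟨k, rfl⟩ := Nat.exists_eq_succ_of_ne_zero hk.ne'
  -- After the shift of `k` there are up to `k + 1` exceptional rows; `ℓ ≥ 2 * k + 4` makes them,
  -- with the tenth of a row, less than half of all rows.
  refine ⟨2 * k + 3, by omega, fun ℓ hℓ => ?_⟩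
  have key : ∀ C : LayeredCircuit ℝ (Fin (ℓ ^ (2 * (k + 1)))), C.IsMonotone → C.width ≤ k + 1 →
      C.poly.support ⊆ (altPoly ℓ (k + 1)).support →
      ((altPoly ℓ (k + 1)).support.card : ℝ) / 2 ≤ (C.poly.support.card : ℝ) →
      (2 : ℝ) ^ ℓ / 10 ≤ (C.size : ℝ) := by
    intro C hC hw hsub hcard
    have hcard' : (altPoly ℓ (k + 1)).support.card ≤ 2 * C.poly.support.card := by
      have : ((altPoly ℓ (k + 1)).support.card : ℝ) ≤ 2 * C.poly.support.card := by linarith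
      exact_mod_cast this
    have h := hC.two_pow_le_size hℓ hw hsub hcard'
    rw [div_le_iff₀ (by norm_num), mul_comm]
    exact_mod_cast h
  refine ⟨key, fun C hC hw h => key C hC hw (by rw [h]) ?_⟩
  rw [h]
  exact half_le_self (Nat.cast_nonneg _)
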